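/- For a proper metric space $X$ let $C_h(X)$ be the $C^*$-algebra of all bounded continuous functions $f\colon X\to\mathbb{C}$ such that, for every $r>0$, $\operatorname{diam} f(B(x,r))\to 0$ as $x\to\infty$, where $B(x,r)$ is the ball of radius $r$ centred at $x$. The Higson compactification $hX$ is the compactification of $X$ with $C(hX)=C_h(X)$, that is, the Gelfand spectrum of $C_h(X)$ with $X$ embedded by point evaluations, and the Higson corona is $\nu X=hX\setminus X$. Given base points $e\in X$, $e'\in Y$, a map $f\colon X\to Y$ is coarse if there is $A>0$ with $d(e',f(x))\ge d(e,x)/A-A$ and $d(f(x),f(x'))\le A\,d(x,x')+A$ for all $x,x'\in X$. A continuous coarse map $f\colon X\to Y$ of proper metric spaces extends to a continuous map $hf\colon hX\to hY$ (induced by $g\mapsto g\circ f$), which maps $\nu X$ into $\nu Y$; put $\nu f:=hf|_{\nu X}\colon\nu X\to\nu Y$. Let $\mathbb{Z}^n$ carry the Euclidean metric and the base point $0$, and let $T\colon\mathbb{Z}^n\to\mathbb{Z}^n$ be an injective $\mathbb{Z}$-linear map (so that $T$ is a coarse map). If $T$ has an eigenvalue $\lambda\in\mathbb{C}$ with $\lambda\neq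 1$, then the induced map $\nu T\colon\nu\mathbb{Z}^n\to\nu\mathbb{Z}^n$ is not homotopic to the identity $\mathrm{id}_{\nu\mathbb{Z}^n}$. -/

import Mathlib

open Filter Topology Bornology
open scoped BoundedContinuousFunction

noncomputable section

namespace HigsonCorona

/-! ### The Higson algebra `C_h(X)` -/

/-- `IsHigson f`: for every `r > 0`, the diameter of `f (B(x, r))` tends to `0` as `x` tends to
infinity (i.e. as `d(e, x) → ∞` for one, equivalently every, base point `e`). -/
def IsHigson {X : Type*} [MetricSpace X] (f : X → ℂ) : Prop :=
  ∀ r : ℝ, 0 < r → Tendsto (fun x => Metric.diam (f '' Metric.ball x r)) (cobounded X) (𝓝 0)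

theorem isHigson_iff {X : Type*} [MetricSpace X] (f : X →ᵇ ℂ) :
    IsHigson f ↔ ∀ r : ℝ, 0 < r → ∀ ε : ℝ, 0 < ε → ∀ᶠ x in cobounded X,
      ∀ y ∈ Metric.ball x r, ∀ z ∈ Metric.ball x r, dist (f y) (f z) ≤ ε := by
  have hb : ∀ s : Set X, IsBounded (f '' s) := fun s =>
    f.isBounded_range.subset (Set.image_subset_range _ _)
  constructor
  · intro h r hr ε hε
    filter_upwards [(h r hr).eventually (gt_mem_nhds hε)] with x hx y hy z hz
    exact (Metric.dist_le_diam_of_mem (hb _) (Set.mem_image_of_mem _ hy)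
      (Set.mem_image_of_mem _ hz)).trans hx.le
  · intro h r hr
    rw [Metric.tendsto_nhds]
    intro ε hε
    filter_upwards [h r hr (ε / 2) (by positivity)] with x hx
    rw [Real.dist_eq, sub_zero, abs_of_nonneg Metric.diam_nonneg]
    refine lt_of_le_of_lt (Metric.diam_le_of_forall_dist_le (by positivity) ?_) (half_lt_self hε)
    rintro _ ⟨y, hy, rfl⟩ _ ⟨z, hz, rfl⟩
    exact hx y hy z hz

/-- The Higson algebra `C_h(X) ⊆ C_b(X)`. -/
def higsonAlgebra (X : Type*) [MetricSpace X] : StarSubalgebra ℂ (X →ᵇ ℂ) where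
  carrier := {f | IsHigson f}
  add_mem' {f g} hf hg := by
    simp only [Set.mem_ofPred_eq, isHigson_iff] at hf hg ⊢
    intro r hr ε hε
    filter_upwards [hf r hr (ε / 2) (by positivity), hg r hr (ε / 2) (by positivity)]
      with x h1 h2 y hy z hz
    have := dist_add_add_le (f y) (g y) (f z) (g z)
    simp only [BoundedContinuousFunction.coe_add, Pi.add_apply]
    linarith [h1 y hy z hz, h2 y hy z hz]
  mul_mem' {f g} hf hg := by
    simp only [Set.mem_ofPred_eq, isHigson_iff] at hf hg ⊢
    intro r hr ε hε
    have hF : 0 < ‖f‖ + 1 := by positivity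
    have hG : 0 < ‖g‖ + 1 := by positivity
    filter_upwards [hf r hr (ε / 2 / (‖g‖ + 1)) (by positivity),
      hg r hr (ε / 2 / (‖f‖ + 1)) (by positivity)] with x h1 h2 y hy z hz
    have e1 := h1 y hy z hz
    have e2 := h2 y hy z hz
    rw [le_div_iff₀ hG, dist_eq_norm] at e1
    rw [le_div_iff₀ hF, dist_eq_norm] at e2
    simp only [BoundedContinuousFunction.coe_mul, Pi.mul_apply]
    rw [dist_eq_norm, show f y * g y - f z * g z = (f y - f z) * g y + f z * (g y - g z) by ring]
    refine (norm_add_le _ _).trans ?_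
    rw [norm_mul, norm_mul]
    have a1 : ‖f y - f z‖ * ‖g y‖ ≤ ‖f y - f z‖ * (‖g‖ + 1) :=
      mul_le_mul_of_nonneg_left ((g.norm_coe_le_norm y).trans (by linarith)) (norm_nonneg _)
    have a2 : ‖f z‖ * ‖g y - g z‖ ≤ (‖f‖ + 1) * ‖g y - g z‖ :=
      mul_le_mul_of_nonneg_right ((f.norm_coe_le_norm z).trans (by linarith)) (norm_nonneg _)
    linarith
  algebraMap_mem' c := by
    simp only [Set.mem_ofPred_eq, isHigson_iff]
    intro r hr ε hε
    refine Eventually.of_forall fun x y _ z _ => ?_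
    simpa [BoundedContinuousFunction.algebraMap_apply] using hε.le
  star_mem' {f} hf := by
    simp only [Set.mem_ofPred_eq, isHigson_iff] at hf ⊢
    intro r hr ε hε
    filter_upwards [hf r hr ε hε] with x h1 y hy z hz
    have := h1 y hy z hz
    rw [dist_eq_norm] at this ⊢
    simpa [← map_sub] using this

theorem mem_higsonAlgebra {X : Type*} [MetricSpace X] {f : X →ᵇ ℂ} :
    f ∈ higsonAlgebra X ↔ IsHigson f := Iff.rfl

theorem isClosed_higsonAlgebra (X : Type*) [MetricSpace X] :
    IsClosed (higsonAlgebra X : Set (X →ᵇ ℂ)) := by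
  refine isClosed_of_closure_subset fun f hf => ?_
  rw [SetLike.mem_coe, mem_higsonAlgebra, isHigson_iff]
  intro r hr ε hε
  obtain ⟨g, hg, hfg⟩ := Metric.mem_closure_iff.1 hf (ε / 3) (by positivity)
  rw [SetLike.mem_coe, mem_higsonAlgebra, isHigson_iff] at hg
  filter_upwards [hg r hr (ε / 3) (by positivity)] with x h1 y hy z hz
  have e1 := (BoundedContinuousFunction.dist_coe_le_dist (f := f) (g := g) y).trans hfg.le
  have e2 := (BoundedContinuousFunction.dist_coe_le_dist (f := f) (g := g) z).trans hfg.le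
  have e3 := dist_triangle4 (f y) (g y) (g z) (f z)
  rw [dist_comm (g z)] at e3
  linarith [h1 y hy z hz]

instance (X : Type*) [MetricSpace X] : CompleteSpace (higsonAlgebra X) :=
  (isClosed_higsonAlgebra X).completeSpace_coe

/-- Bounded continuous functions with bounded support are Higson functions. -/
theorem isHigson_of_isBounded {X : Type*} [MetricSpace X] (f : X →ᵇ ℂ) {s : Set X}
    (hs : IsBounded s) (hf : ∀ x, x ∉ s → f x = 0) : f ∈ higsonAlgebra X := by
  rw [mem_higsonAlgebra, isHigson_iff]
  intro r hr ε hε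
  have hs' : IsBounded (Metric.thickening r s) := hs.thickening
  filter_upwards [isBounded_def.1 hs'] with x hx
  have h0 : ∀ y ∈ Metric.ball x r, f y = 0 := by
    intro y hy
    refine hf y fun hys => hx ?_
    rw [Metric.mem_thickening_iff]
    exact ⟨y, hys, by rwa [dist_comm]⟩
  intro y hy z hz
  simpa [h0 y hy, h0 z hz] using hε.le

/-! ### Higson compactification and Higson corona -/

/-- The Higson compactification `hX`: the Gelfand spectrum of `C_h(X)`, so that
`C(hX) = C_h(X)`. -/
abbrev HigsonCompactification (X : Type*) [MetricSpace X] : Type _ :=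
  WeakDual.characterSpace ℂ (higsonAlgebra X)

/-- The canonical map `X → hX`, sending a point to the evaluation at that point. -/
def toHigson {X : Type*} [MetricSpace X] (x : X) : HigsonCompactification X :=
  WeakDual.CharacterSpace.equivAlgHom.symm
    { toFun := fun f => f.1 x
      map_one' := rfl
      map_mul' := fun _ _ => rfl
      map_zero' := rfl
      map_add' := fun _ _ => rfl
      commutes' := fun _ => rfl }

@[simp]
theorem toHigson_apply {X : Type*} [MetricSpace X] (x : X) (f : higsonAlgebra X) :
    toHigson x f = f.1 x := rfl

/-- The Higson corona `νX = hX \ X`, with the subspace topology. -/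
abbrev Corona (X : Type*) [MetricSpace X] : Type _ :=
  {χ : HigsonCompactification X // χ ∉ Set.range (toHigson (X := X))}

/-! ### Coarse maps and the induced maps -/

/-- Coarse maps between metric spaces `X`, `Y` with base points `e`, `e'`. -/
def IsCoarse {X Y : Type*} [MetricSpace X] [MetricSpace Y] (e : X) (e' : Y) (f : X → Y) : Prop :=
  ∃ A : ℝ, 0 < A ∧ (∀ x, dist e x / A - A ≤ dist e' (f x)) ∧
    ∀ x x', dist (f x) (f x') ≤ A * dist x x' + A

theorem IsCoarse.tendsto_cobounded {X Y : Type*} [MetricSpace X] [MetricSpace Y] {e : X} {e' : Y}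
    {f : X → Y} (hf : IsCoarse e e' f) : Tendsto f (cobounded X) (cobounded Y) := by
  obtain ⟨A, hA, h1, -⟩ := hf
  rw [← Metric.comap_dist_left_atTop e', tendsto_comap_iff]
  refine tendsto_atTop_mono h1 ?_
  exact tendsto_atTop_add_const_right _ _
    ((Metric.tendsto_dist_left_cobounded_atTop e).atTop_div_const hA)

theorem IsCoarse.comp_mem {X Y : Type*} [MetricSpace X] [MetricSpace Y] {e : X} {e' : Y}
    {f : C(X, Y)} (hf : IsCoarse e e' f) {g : Y →ᵇ ℂ} (hg : g ∈ higsonAlgebra Y) :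
    g.compContinuous f ∈ higsonAlgebra X := by
  have ht := hf.tendsto_cobounded
  obtain ⟨A, hA, -, h2⟩ := hf
  rw [mem_higsonAlgebra, isHigson_iff] at hg ⊢
  intro r hr ε hε
  filter_upwards [ht.eventually (hg (A * r + A) (by positivity) ε hε)] with x hx
  have key : ∀ y ∈ Metric.ball x r, f y ∈ Metric.ball (f x) (A * r + A) := by
    intro y hy
    rw [Metric.mem_ball] at hy ⊢
    have := mul_lt_mul_of_pos_left hy hA
    linarith [h2 y x]
  intro y hy z hz
  exact hx _ (key y hy) _ (key z hz)

/-- The `*`-homomorphism `f^* : C_h(Y) → C_h(X)`, `g ↦ g ∘ f`. -/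
def pullback {X Y : Type*} [MetricSpace X] [MetricSpace Y] {e : X} {e' : Y}
    (f : C(X, Y)) (hf : IsCoarse e e' f) : higsonAlgebra Y →⋆ₐ[ℂ] higsonAlgebra X where
  toFun g := ⟨g.1.compContinuous f, hf.comp_mem g.2⟩
  map_one' := rfl
  map_mul' _ _ := rfl
  map_zero' := rfl
  map_add' _ _ := rfl
  commutes' _ := rfl
  map_star' _ := rfl

/-- The map `hf : hX → hY` induced by a continuous coarse map `f : X → Y`. -/
def compactificationMap {X Y : Type*} [MetricSpace X] [MetricSpace Y] {e : X} {e' : Y}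
    (f : C(X, Y)) (hf : IsCoarse e e' f) :
    C(HigsonCompactification X, HigsonCompactification Y) :=
  WeakDual.CharacterSpace.compContinuousMap (pullback f hf)

theorem compactificationMap_apply {X Y : Type*} [MetricSpace X] [MetricSpace Y] {e : X} {e' : Y}
    (f : C(X, Y)) (hf : IsCoarse e e' f) (χ : HigsonCompactification X) (g : higsonAlgebra Y) :
    compactificationMap f hf χ g = χ (pullback f hf g) := rfl

/-- `hf` extends `f`. -/
theorem compactificationMap_toHigson {X Y : Type*} [MetricSpace X] [MetricSpace Y] {e : X} {e' : Y}
    (f : C(X, Y)) (hf : IsCoarse e e' f) (x : X) :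
    compactificationMap f hf (toHigson x) = toHigson (f x) := rfl

/-- A character that is no evaluation vanishes on functions with bounded support. -/
theorem apply_eq_zero_of_corona {X : Type*} [MetricSpace X] [ProperSpace X]
    {χ : HigsonCompactification X} (hχ : χ ∉ Set.range (toHigson (X := X)))
    (u : higsonAlgebra X) {s : Set X} (hs : IsBounded s) (hu : ∀ x, x ∉ s → u.1 x = 0) :
    χ u = 0 := by
  obtain ⟨g, δ, hδ, hg0, -, hgs⟩ : ∃ (g : higsonAlgebra X) (δ : ℝ), 0 < δ ∧ χ g = 0 ∧
      (∀ x, 0 ≤ (g.1 x).re) ∧ ∀ x ∈ closure s, δ ≤ (g.1 x).re := by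
    have hK : IsCompact (closure s) := hs.isCompact_closure
    refine hK.induction_on ?_ ?_ ?_ ?_
    · exact ⟨0, 1, one_pos, map_zero χ, fun x => by simp, by simp⟩
    · rintro s t hst ⟨g, δ, h1, h2, h3, h4⟩
      exact ⟨g, δ, h1, h2, h3, fun x hx => h4 x (hst hx)⟩
    · rintro s t ⟨g, δ, h1, h2, h3, h4⟩ ⟨g', δ', h1', h2', h3', h4'⟩
      refine ⟨g + g', min δ δ', lt_min h1 h1', by rw [map_add, h2, h2', add_zero], fun x => ?_,
        fun x hx => ?_⟩
      · have := add_nonneg (h3 x) (h3' x)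
        simpa using this
      · have hadd : ((g + g').1 x).re = (g.1 x).re + (g'.1 x).re := by simp
        rw [hadd]
        rcases hx with hx | hx
        · linarith [h4 x hx, h3' x, min_le_left δ δ']
        · linarith [h4' x hx, h3 x, min_le_right δ δ']
    · intro x _
      have hne : toHigson x ≠ χ := fun h => hχ ⟨x, h⟩
      obtain ⟨p, hp⟩ : ∃ p, χ p ≠ toHigson x p := by
        by_contra hcon
        push Not at hcon
        exact hne (WeakDual.CharacterSpace.ext fun p => (hcon p).symm)
      let q : higsonAlgebra X := p - algebraMap ℂ _ (χ p)
      have hq0 : χ q = 0 := by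
        simp only [q, map_sub, AlgHomClass.commutes]
        simp
      have hqx : q.1 x ≠ 0 := by
        have : q.1 x = p.1 x - χ p := rfl
        rw [this, sub_ne_zero]
        exact fun h => hp h.symm
      have hre : ∀ y, ((star q * q).1 y).re = ‖q.1 y‖ ^ 2 := by
        intro y
        have : (star q * q).1 y = (starRingEnd ℂ) (q.1 y) * q.1 y := rfl
        rw [this, Complex.conj_mul']
        norm_cast
      have hpos : 0 < ‖q.1 x‖ ^ 2 := by positivity
      have hcont : Continuous fun y => ‖q.1 y‖ ^ 2 := by fun_prop
      refine ⟨{y | ‖q.1 x‖ ^ 2 / 2 < ‖q.1 y‖ ^ 2}, ?_, star q * q, ‖q.1 x‖ ^ 2 / 2,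
        by positivity, by rw [map_mul, hq0, mul_zero], fun y => ?_, fun y hy => ?_⟩
      · exact mem_nhdsWithin_of_mem_nhds
          (hcont.continuousAt.eventually (lt_mem_nhds (half_lt_self hpos)))
      · rw [hre]; positivity
      · rw [hre]; exact le_of_lt hy
  have hmax : ∀ x, 0 < max (‖g.1 x‖ ^ 2) (δ ^ 2) := fun x => lt_max_of_lt_right (by positivity)
  let k : X →ᵇ ℂ := BoundedContinuousFunction.ofNormedAddCommGroup
    (fun x => u.1 x * (starRingEnd ℂ) (g.1 x) / ((max (‖g.1 x‖ ^ 2) (δ ^ 2) : ℝ) : ℂ))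
    (by
      refine Continuous.div ?_ ?_ ?_
      · exact (u.1.continuous).mul (Complex.continuous_conj.comp g.1.continuous)
      · exact Complex.continuous_ofReal.comp
          (((g.1.continuous.norm).pow 2).max continuous_const)
      · intro x
        exact_mod_cast (hmax x).ne')
    (‖u.1‖ * ‖g.1‖ / δ ^ 2)
    (by
      intro x
      rw [norm_div, norm_mul, RCLike.norm_conj, Complex.norm_real, Real.norm_eq_abs,
        abs_of_pos (hmax x)]
      have := u.1.norm_coe_le_norm x
      have := g.1.norm_coe_le_norm x
      gcongr
      exact le_max_right _ _)
  have hk : k ∈ higsonAlgebra X := isHigson_of_isBounded k hs fun x hx => by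
    change u.1 x * (starRingEnd ℂ) (g.1 x) / _ = 0
    rw [hu x hx, zero_mul, zero_div]
  have huk : u = g * ⟨k, hk⟩ := by
    refine Subtype.ext (BoundedContinuousFunction.ext fun x => ?_)
    change u.1 x = g.1 x *
      (u.1 x * (starRingEnd ℂ) (g.1 x) / ((max (‖g.1 x‖ ^ 2) (δ ^ 2) : ℝ) : ℂ))
    by_cases hx : x ∈ s
    · have h1 : δ ≤ ‖g.1 x‖ := (hgs x (subset_closure hx)).trans (Complex.re_le_norm _)
      have h2 : max (‖g.1 x‖ ^ 2) (δ ^ 2) = ‖g.1 x‖ ^ 2 :=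
        max_eq_left (pow_le_pow_left₀ hδ.le h1 2)
      have h3 : ((‖g.1 x‖ : ℂ)) ≠ 0 := by exact_mod_cast (hδ.trans_le h1).ne'
      rw [h2, mul_div_assoc', eq_div_iff (by push_cast; exact pow_ne_zero 2 h3)]
      rw [show g.1 x * (u.1 x * (starRingEnd ℂ) (g.1 x))
        = u.1 x * (g.1 x * (starRingEnd ℂ) (g.1 x)) by ring, Complex.mul_conj']
      push_cast
      rfl
    · rw [hu x hx]; simp
  rw [huk, map_mul, hg0, zero_mul]

/-- `hf` maps `νX` into `νY`. -/
theorem compactificationMap_mem_corona {X Y : Type*} [MetricSpace X] [ProperSpace X]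
    [MetricSpace Y] {e : X} {e' : Y} (f : C(X, Y)) (hf : IsCoarse e e' f)
    {χ : HigsonCompactification X} (hχ : χ ∉ Set.range (toHigson (X := X))) :
    compactificationMap f hf χ ∉ Set.range (toHigson (X := Y)) := by
  rintro ⟨y, hy⟩
  let u : Y →ᵇ ℂ := BoundedContinuousFunction.ofNormedAddCommGroup
    (fun z => ((max 0 (1 - dist z y) : ℝ) : ℂ)) (by fun_prop) 1 (by
      intro z
      rw [Complex.norm_real, Real.norm_eq_abs, abs_of_nonneg (le_max_left _ _)]
      exact max_le zero_le_one (by linarith [dist_nonneg (x := z) (y := y)]))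
  have hu0 : ∀ z, z ∉ Metric.ball y 1 → u z = 0 := by
    intro z hz
    rw [Metric.mem_ball, not_lt] at hz
    change ((max 0 (1 - dist z y) : ℝ) : ℂ) = 0
    rw [max_eq_left (by linarith)]
    rfl
  have hu1 : u y = 1 := by
    change ((max 0 (1 - dist y y) : ℝ) : ℂ) = 1
    simp
  let v : higsonAlgebra Y := ⟨u, isHigson_of_isBounded u Metric.isBounded_ball hu0⟩
  have h1 : compactificationMap f hf χ v = 1 := by
    rw [← hy]; exact hu1
  rw [compactificationMap_apply] at h1
  have hbdd : IsBounded (f ⁻¹' Metric.ball y 1) := by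
    have h := hf.tendsto_cobounded (isBounded_def.1 (Metric.isBounded_ball (x := y) (r := 1)))
    rw [isBounded_def]
    exact h
  have h0 := apply_eq_zero_of_corona hχ (pullback f hf v) hbdd fun x hx => hu0 (f x) hx
  rw [h0] at h1
  exact zero_ne_one h1

/-- The map `νf : νX → νY` induced by a continuous coarse map `f : X → Y`: the restriction
of `hf`. -/
def coronaMap {X Y : Type*} [MetricSpace X] [ProperSpace X] [MetricSpace Y] {e : X} {e' : Y}
    (f : C(X, Y)) (hf : IsCoarse e e' f) : C(Corona X, Corona Y) where
  toFun χ := ⟨compactificationMap f hf χ.1, compactificationMap_mem_corona f hf χ.2⟩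
  continuous_toFun :=
    ((compactificationMap f hf).continuous.comp continuous_subtype_val).subtype_mk _

/-! ### The lattice `ℤ^n` and its injective linear maps -/

/-- `ℤ^n` with the Euclidean metric; its base point is `0`. -/
abbrev IntLattice (n : ℕ) : Type := PiLp 2 (fun _ : Fin n => ℤ)

instance (n : ℕ) : ProperSpace (IntLattice n) :=
  (PiLp.antilipschitzWith_toLp 2 (fun _ : Fin n => ℤ)).properSpace
    (PiLp.continuous_toLp 2 _) (WithLp.toLp_surjective 2)

theorem exists_bound {n : ℕ} (T : IntLattice n →ₗ[ℤ] IntLattice n) :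
    ∃ C : ℝ, 0 < C ∧ ∀ x, ‖T x‖ ≤ C * ‖x‖ := by
  let b := PiLp.basisFun 2 ℤ (Fin n)
  refine ⟨(∑ i, ‖T (b i)‖) + 1, by positivity, fun x => ?_⟩
  have hx : T x = ∑ i, x i • T (b i) := by
    conv_lhs => rw [← b.sum_repr x, map_sum]
    simp [b]
  rw [hx, add_mul, Finset.sum_mul]
  have hle : ∀ i ∈ Finset.univ, ‖x i • T (b i)‖ ≤ ‖T (b i)‖ * ‖x‖ := by
    intro i _
    rw [mul_comm]
    refine (norm_zsmul_le _ _).trans ?_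
    exact mul_le_mul_of_nonneg_right (by simpa using PiLp.norm_apply_le x i) (norm_nonneg _)
  linarith [norm_sum_le_of_le _ hle, norm_nonneg x]

/-- An injective linear map of `ℤ^n` is coarse. -/
theorem isCoarse_of_injective {n : ℕ} (T : IntLattice n →ₗ[ℤ] IntLattice n)
    (hT : Function.Injective T) : IsCoarse (0 : IntLattice n) (0 : IntLattice n) T := by
  let b := PiLp.basisFun 2 ℤ (Fin n)
  let S := Matrix.toLin b b (LinearMap.toMatrix b b T).adjugate
  have hST : ∀ x, S (T x) = T.det • x := by
    intro x
    have h : S ∘ₗ T = T.det • LinearMap.id := by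
      apply (LinearMap.toMatrix b b).injective
      rw [LinearMap.toMatrix_comp b b b, LinearMap.toMatrix_toLin, Matrix.adjugate_mul,
        LinearMap.det_toMatrix, map_smul, LinearMap.toMatrix_id]
    exact congrArg (fun L => L x) h
  have : Module.Free ℤ (IntLattice n) := Module.Free.of_basis b
  have hdet : T.det ≠ 0 := by
    intro h
    exact (LinearMap.bot_lt_ker_of_det_eq_zero h).ne' (LinearMap.ker_eq_bot.2 hT)
  obtain ⟨C, hC, hTC⟩ := exists_bound T
  obtain ⟨D, hD, hSD⟩ := exists_bound S
  have hlow : ∀ x, ‖x‖ ≤ D * ‖T x‖ := by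
    intro x
    refine le_trans ?_ (hSD (T x))
    rw [hST, norm_smul]
    have : (1 : ℝ) ≤ ‖T.det‖ := by
      rw [Int.norm_eq_abs]
      exact_mod_cast Int.one_le_abs hdet
    nlinarith [norm_nonneg x]
  refine ⟨C + D, by positivity, fun x => ?_, fun x x' => ?_⟩
  · rw [dist_zero_left, dist_zero_left, sub_le_iff_le_add, div_le_iff₀ (by positivity)]
    nlinarith [hlow x, norm_nonneg (T x), mul_pos hC hD]
  · rw [dist_eq_norm, dist_eq_norm, ← map_sub]
    nlinarith [hTC (x - x'), norm_nonneg (x - x')]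

/-- A linear map of `ℤ^n` as a continuous map. -/
def toContinuousMap {n : ℕ} (T : IntLattice n →ₗ[ℤ] IntLattice n) :
    C(IntLattice n, IntLattice n) where
  toFun := T
  continuous_toFun := by
    obtain ⟨C, -, hC⟩ := exists_bound T
    exact AddMonoidHomClass.continuous_of_bound T C hC

end HigsonCorona

end

/-!
The corona map `νT` of an injective linear map `T` of `ℤ^n` is not homotopic to the identity as
soon as `T ≠ id`; an eigenvalue `μ ≠ 1` is used only to exclude `T = id`.

Call a real function `φ` on a metric space `X` slowly oscillating if it satisfies the Higson
condition, without any boundedness. For such `φ` the circle-valued function `exp (iφ)` belongs to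
`C_h(X)`, so it extends to a continuous map `hX → S¹`. If `νf` and `νg` are homotopic, the quotient
of the pullbacks of this map under `νf` and `νg` is null-homotopic on the corona. By the homotopy
lifting property of the covering `ℝ → S¹` it is therefore of the form `exp (iθ)` with
`θ : νX → ℝ` continuous. By Tietze's theorem (the corona is closed in `hX`) and Gelfand duality,
`θ` comes from a *bounded* slowly oscillating function `H` on `X`, and
`exp (i (φ ∘ g - φ ∘ f - H)) → 1` at infinity
(`exists_bounded_slowlyOscillating_of_homotopic`).

Along a sequence that tends to infinity with bounded steps, the real number `φ ∘ g - φ ∘ f - H`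
changes by amounts tending to `0` and gets arbitrarily close to `2πℤ`, so it stays bounded
(`exists_bound_of_tendsto_exp_one`). Hence `φ ∘ g - φ ∘ f` is bounded along such sequences.

For `ℤ^n` this is applied to `φ_i(x) = x_i / √(1 + ‖x‖)` along the sequence `k • v`, where
`T v ≠ v`. Since `φ_i(k • x) / √k → x_i / √‖x‖`, boundedness of
`φ_i(k • T v) - φ_i(k • v)` for all `i` would give `T v / √‖T v‖ = v / √‖v‖`. Taking norms,
`‖T v‖ = ‖v‖`, and so `T v = v`, a contradiction.
-/

open scoped unitInterval

noncomputable section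

namespace HigsonCorona

/-! ### Slowly oscillating real functions -/

/-- A real function on a metric space, not necessarily bounded, is slowly oscillating if for every
`r > 0` its oscillation on `B(x, r)` tends to `0` as `x` tends to infinity. The condition is written
with distances since the diameter of an unbounded set has the junk value `0`. -/
def IsSlowlyOscillating {X : Type*} [MetricSpace X] (φ : X → ℝ) : Prop :=
  ∀ r : ℝ, 0 < r → ∀ ε : ℝ, 0 < ε → ∀ᶠ x in cobounded X,
    ∀ y ∈ Metric.ball x r, ∀ z ∈ Metric.ball x r, dist (φ y) (φ z) ≤ ε

section

variable {X Y : Type*} [MetricSpace X] [MetricSpace Y]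

theorem IsSlowlyOscillating.sub {φ ψ : X → ℝ} (hφ : IsSlowlyOscillating φ)
    (hψ : IsSlowlyOscillating ψ) : IsSlowlyOscillating (fun x => φ x - ψ x) := by
  intro r hr ε hε
  filter_upwards [hφ r hr (ε / 2) (by positivity), hψ r hr (ε / 2) (by positivity)]
    with x h1 h2 y hy z hz
  linarith [h1 y hy z hz, h2 y hy z hz, dist_sub_sub_le (φ y) (ψ y) (φ z) (ψ z)]

theorem IsSlowlyOscillating.comp_isCoarse {e : X} {e' : Y} {f : X → Y} (hf : IsCoarse e e' f)
    {φ : Y → ℝ} (hφ : IsSlowlyOscillating φ) : IsSlowlyOscillating (fun x => φ (f x)) := by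
  have ht := hf.tendsto_cobounded
  obtain ⟨A, hA, -, h2⟩ := hf
  intro r hr ε hε
  filter_upwards [ht.eventually (hφ (A * r + A) (by positivity) ε hε)] with x hx
  have key : ∀ y ∈ Metric.ball x r, f y ∈ Metric.ball (f x) (A * r + A) := by
    intro y hy
    rw [Metric.mem_ball] at hy ⊢
    have := mul_lt_mul_of_pos_left hy hA
    linarith [h2 y x]
  intro y hy z hz
  exact hx _ (key y hy) _ (key z hz)

theorem IsSlowlyOscillating.tendsto_sub {φ : X → ℝ} (hφ : IsSlowlyOscillating φ) {x : ℕ → X}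
    (hx : Tendsto x atTop (cobounded X)) {C : ℝ} (hC : ∀ k, dist (x (k + 1)) (x k) ≤ C) :
    Tendsto (fun k => φ (x (k + 1)) - φ (x k)) atTop (𝓝 0) := by
  have hC0 : 0 ≤ C := dist_nonneg.trans (hC 0)
  rw [Metric.tendsto_nhds]
  intro ε hε
  filter_upwards [hx.eventually (hφ (C + 1) (by positivity) (ε / 2) (by positivity))] with k hk
  have := hk (x (k + 1)) (by rw [Metric.mem_ball]; linarith [hC k]) (x k)
    (Metric.mem_ball_self (by positivity))
  rw [dist_zero_right, ← dist_eq_norm]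
  linarith

/-- The real part of a Higson function is slowly oscillating. -/
theorem isSlowlyOscillating_re (u : higsonAlgebra X) :
    IsSlowlyOscillating (fun x => (u.1 x).re) := by
  intro r hr ε hε
  filter_upwards [(isHigson_iff u.1).1 u.2 r hr ε hε] with x hx y hy z hz
  refine le_trans ?_ (hx y hy z hz)
  rw [dist_eq_norm, dist_eq_norm, ← Complex.sub_re]
  exact Complex.abs_re_le_norm _

/-- A real sequence whose increments tend to `0` and which approaches `2πℤ` is bounded: the
nearest elements of `2πℤ` are eventually constant. -/
theorem exists_bound_of_tendsto_exp_one {b : ℕ → ℝ}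
    (hstep : Tendsto (fun k => b (k + 1) - b k) atTop (𝓝 0))
    (hexp : Tendsto (fun k => Circle.exp (b k)) atTop (𝓝 1)) :
    ∃ B, ∀ᶠ k in atTop, |b k| ≤ B := by
  set a : ℕ → ℝ := fun k => Complex.arg (Circle.exp (b k)) with ha
  have harg : Tendsto a atTop (𝓝 0) := by
    have h1 : Tendsto (fun k => ((Circle.exp (b k) : Circle) : ℂ)) atTop (𝓝 1) :=
      (continuous_subtype_val.tendsto (1 : Circle)).comp hexp
    have h2 := (Complex.continuousAt_arg (x := 1) (by simp)).tendsto.comp h1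
    rwa [Complex.arg_one] at h2
  have hc : ∀ k, ∃ m : ℤ, b k = a k + m * (2 * Real.pi) := fun k =>
    Circle.exp_eq_exp.1 (Circle.exp_arg _).symm
  choose c hc using hc
  have hev : ∀ᶠ k in atTop, |b (k + 1) - b k| < 1 ∧ |a k| < 1 := by
    have h1 := (hstep.abs).eventually (gt_mem_nhds (show |(0 : ℝ)| < 1 by simp))
    have h2 := (harg.abs).eventually (gt_mem_nhds (show |(0 : ℝ)| < 1 by simp))
    exact h1.and h2
  obtain ⟨N, hN⟩ := eventually_atTop.1 hev
  have hconst : ∀ k, N ≤ k → c k = c N := by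
    intro k hk
    induction k, hk using Nat.le_induction with
    | base => rfl
    | succ k hk ih =>
      rw [← ih]
      have h1 := abs_lt.1 (hN k hk).1
      have h2 := abs_lt.1 (hN k hk).2
      have h3 := abs_lt.1 (hN (k + 1) (by omega)).2
      have e1 := hc k
      have e2 := hc (k + 1)
      have hpi := Real.pi_gt_three
      -- The three errors add up to less than `3 < 2π`.
      have l1 : ((c (k + 1) : ℝ) - c k) < 1 := by
        by_contra hcon
        nlinarith
      have l2 : -1 < ((c (k + 1) : ℝ) - c k) := by
        by_contra hcon
        nlinarith
      have l1' : c (k + 1) - c k < 1 := by exact_mod_cast l1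
      have l2' : -1 < c (k + 1) - c k := by exact_mod_cast l2
      omega
  refine ⟨1 + |(c N : ℝ) * (2 * Real.pi)|, eventually_atTop.2 ⟨N, fun k hk => ?_⟩⟩
  rw [hc k, hconst k hk]
  exact (abs_add_le _ _).trans (by linarith [(hN k hk).2])

/-! ### Functions on the Higson compactification -/

/-- The norm-closed `*`-subalgebra `C_h(X)` of `C_b(X)` is a commutative `C^*`-algebra, so Gelfand
duality applies to it. -/
instance : CommCStarAlgebra (higsonAlgebra X) where

/-- The tent function around `y`, a Higson function of bounded support. -/
def tent (y : X) : higsonAlgebra X :=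
  ⟨BoundedContinuousFunction.ofNormedAddCommGroup
    (fun z => ((max 0 (1 - dist z y) : ℝ) : ℂ)) (by fun_prop) 1 (by
      intro z
      rw [Complex.norm_real, Real.norm_eq_abs, abs_of_nonneg (le_max_left _ _)]
      exact max_le zero_le_one (by linarith [dist_nonneg (x := z) (y := y)])),
    isHigson_of_isBounded _ (Metric.isBounded_ball (x := y) (r := 1)) (by
      intro z hz
      rw [Metric.mem_ball, not_lt] at hz
      change ((max 0 (1 - dist z y) : ℝ) : ℂ) = 0
      rw [max_eq_left (by linarith)]
      rfl)⟩

theorem tent_apply (y z : X) : (tent y).1 z = ((max 0 (1 - dist z y) : ℝ) : ℂ) := rfl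

theorem tent_eq_zero {y z : X} (hz : z ∉ Metric.ball y 1) : (tent y).1 z = 0 := by
  rw [Metric.mem_ball, not_lt] at hz
  rw [tent_apply, max_eq_left (by linarith)]
  rfl

theorem continuous_eval (u : higsonAlgebra X) :
    Continuous fun χ : HigsonCompactification X => χ u :=
  (WeakDual.gelfandTransform ℂ (higsonAlgebra X) u).continuous

variable [ProperSpace X]

/-- The corona is the set of common zeros of the tent functions. -/
theorem mem_corona_iff (χ : HigsonCompactification X) :
    χ ∉ Set.range (toHigson (X := X)) ↔ ∀ y : X, χ (tent y) = 0 := by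
  constructor
  · intro hχ y
    exact apply_eq_zero_of_corona hχ _ Metric.isBounded_ball fun x hx => tent_eq_zero hx
  · rintro h ⟨y, rfl⟩
    have := h y
    rw [toHigson_apply, tent_apply] at this
    simp at this

theorem isClosed_corona : IsClosed {χ | χ ∉ Set.range (toHigson (X := X))} := by
  simp only [mem_corona_iff, Set.ofPred_forall]
  exact isClosed_iInter fun y => isClosed_eq (continuous_eval _) continuous_const

/-- Neighbourhoods of the corona contain all points of `X` outside a bounded set. -/
theorem eventually_toHigson_mem {U : Set (HigsonCompactification X)} (hU : IsOpen U)
    (h : ∀ χ, χ ∉ Set.range (toHigson (X := X)) → χ ∈ U) :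
    ∀ᶠ x in cobounded X, toHigson x ∈ U := by
  have hK : IsCompact Uᶜ := hU.isClosed_compl.isCompact
  obtain ⟨t, ht⟩ := hK.elim_finite_subcover
    (fun y : X => {χ : HigsonCompactification X | χ (tent y) ≠ 0})
    (fun y => isOpen_ne_fun (continuous_eval _) continuous_const) (by
      intro χ hχ
      have : ¬ ∀ y : X, χ (tent y) = 0 := fun hc => hχ (h χ ((mem_corona_iff χ).2 hc))
      push Not at this
      exact Set.mem_iUnion.2 this)
  have hb : IsBounded (⋃ y ∈ t, Metric.ball y (1 : ℝ)) :=
    (isBounded_biUnion_finset t).2 fun _ _ => Metric.isBounded_ball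
  filter_upwards [isBounded_def.1 hb] with x hx
  by_contra hxU
  obtain ⟨y, hy⟩ := Set.mem_iUnion.1 (ht hxU)
  obtain ⟨hyt, hy⟩ := Set.mem_iUnion.1 hy
  refine hy ?_
  rw [toHigson_apply]
  exact tent_eq_zero fun hc => hx (Set.mem_biUnion hyt hc)

/-- Every continuous real function on the corona is the boundary value of a Higson function on `X`,
and in particular of a bounded slowly oscillating one (Tietze's theorem and Gelfand duality). -/
theorem exists_extension_of_corona (θ : C(Corona X, ℝ)) :
    ∃ Θ : C(HigsonCompactification X, ℝ), (∀ χ : Corona X, Θ χ.1 = θ χ) ∧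
      IsSlowlyOscillating (fun x : X => Θ (toHigson x)) ∧
      ∃ C, ∀ x : X, |Θ (toHigson x)| ≤ C := by
  obtain ⟨Θ, hΘ⟩ := ContinuousMap.exists_extension
    (isClosed_corona (X := X)).isClosedEmbedding_subtypeVal θ
  refine ⟨Θ, fun χ => congrArg (fun F => F χ) hΘ, ?_, ?_⟩
  · obtain ⟨u, hu⟩ := (gelfandTransform_bijective (higsonAlgebra X)).surjective
      ⟨fun χ => (Θ χ : ℂ), by fun_prop⟩
    have hre : (fun x : X => Θ (toHigson x)) = fun x => (u.1 x).re := by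
      funext x
      have := congrArg (fun F => F (toHigson x)) hu
      change u.1 x = (Θ (toHigson x) : ℂ) at this
      rw [this, Complex.ofReal_re]
    rw [hre]
    exact isSlowlyOscillating_re u
  · exact ⟨‖Θ‖, fun x => Θ.norm_coe_le_norm _⟩

end

/-! ### Phases of slowly oscillating functions and homotopies of corona maps -/

section

variable {X Y : Type*} [MetricSpace X] [MetricSpace Y]

/-- The Higson function `exp (iφ)` of a continuous slowly oscillating function `φ`. -/
def phase (φ : C(X, ℝ)) (hφ : IsSlowlyOscillating φ) : higsonAlgebra X :=
  ⟨BoundedContinuousFunction.ofNormedAddCommGroup (fun x => ((Circle.exp (φ x) : Circle) : ℂ))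
    (by fun_prop) 1 (fun x => (Circle.norm_coe _).le), by
    rw [mem_higsonAlgebra, isHigson_iff]
    intro r hr ε hε
    filter_upwards [hφ r hr ε hε] with x hx y hy z hz
    refine le_trans ?_ (hx y hy z hz)
    change dist ((Circle.exp (φ y) : Circle) : ℂ) ((Circle.exp (φ z) : Circle) : ℂ) ≤ _
    have h : ((Circle.exp (φ y) : Circle) : ℂ) - ((Circle.exp (φ z) : Circle) : ℂ)
        = ((Circle.exp (φ z) : Circle) : ℂ) *
          (Complex.exp (Complex.I * ((φ y - φ z : ℝ) : ℂ)) - 1) := by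
      rw [Circle.coe_exp, Circle.coe_exp, mul_sub, ← Complex.exp_add, mul_one]
      congr 2
      push_cast
      ring
    rw [dist_eq_norm, h, norm_mul, Circle.norm_coe, one_mul, dist_eq_norm]
    exact Real.norm_exp_I_mul_ofReal_sub_one_le⟩

theorem norm_apply_phase (φ : C(X, ℝ)) (hφ : IsSlowlyOscillating φ)
    (χ : HigsonCompactification X) : ‖χ (phase φ hφ)‖ = 1 := by
  have h1 : star (phase φ hφ) * phase φ hφ = 1 := by
    refine Subtype.ext (BoundedContinuousFunction.ext fun x => ?_)
    change (starRingEnd ℂ) ((Circle.exp (φ x) : Circle) : ℂ) *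
      ((Circle.exp (φ x) : Circle) : ℂ) = 1
    rw [Complex.conj_mul', Circle.norm_coe]
    norm_num
  have h2 : (starRingEnd ℂ) (χ (phase φ hφ)) * χ (phase φ hφ) = 1 := by
    have := congrArg χ h1
    rwa [map_mul, map_star, map_one] at this
  rw [Complex.conj_mul'] at h2
  have h3 : ‖χ (phase φ hφ)‖ ^ 2 = 1 := by exact_mod_cast h2
  exact (pow_eq_one_iff_of_nonneg (norm_nonneg _) two_ne_zero).1 h3

/-- The continuous extension `hX → S¹` of `exp (iφ)`. -/
def phaseMap (φ : C(X, ℝ)) (hφ : IsSlowlyOscillating φ) : C(HigsonCompactification X, Circle) where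
  toFun χ := ⟨χ (phase φ hφ), mem_sphere_zero_iff_norm.2 (norm_apply_phase φ hφ χ)⟩
  continuous_toFun := (continuous_eval _).subtype_mk _

/-- The quotient of two homotopic maps to the circle has a continuous real logarithm, by the
homotopy lifting property of `Circle.exp`. -/
theorem exists_exp_eq_div_of_homotopic {A : Type*} [TopologicalSpace A] {f₀ f₁ : C(A, Circle)}
    (h : ContinuousMap.Homotopic f₀ f₁) :
    ∃ θ : C(A, ℝ), ∀ a, Circle.exp (θ a) = f₁ a / f₀ a := by
  obtain ⟨F⟩ := h
  -- Division by `f₀` makes the homotopy start at the constant map `1`, which lifts to `0`.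
  let K : C(I × A, Circle) := ⟨fun p => F p / f₀ p.2, by fun_prop⟩
  have hK : ∀ a, K (0, a) = Circle.exp ((0 : C(A, ℝ)) a) := by
    intro a
    change F (0, a) / f₀ a = Circle.exp 0
    rw [F.apply_zero, div_self', Circle.exp_zero]
  let L := Circle.isCoveringMap_exp.liftHomotopy K 0 hK
  refine ⟨⟨fun a => L (1, a), by fun_prop⟩, fun a => ?_⟩
  have := congrFun (Circle.isCoveringMap_exp.liftHomotopy_lifts K 0 hK) (1, a)
  change Circle.exp (L (1, a)) = F (1, a) / f₀ a at this
  rw [F.apply_one] at this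
  exact this

/-- If `νf` and `νg` are homotopic, then for every slowly oscillating `φ` the difference
`φ ∘ g - φ ∘ f` is, modulo `2πℤ` and up to a term tending to `0`, a bounded slowly oscillating
function. -/
theorem exists_bounded_slowlyOscillating_of_homotopic [ProperSpace X] {e₀ e₁ : X} {e₀' e₁' : Y}
    {f g : C(X, Y)} (hf : IsCoarse e₀ e₀' f) (hg : IsCoarse e₁ e₁' g)
    (h : ContinuousMap.Homotopic (coronaMap f hf) (coronaMap g hg))
    {φ : C(Y, ℝ)} (hφ : IsSlowlyOscillating φ) :
    ∃ H : X → ℝ, IsSlowlyOscillating H ∧ (∃ C, ∀ x, |H x| ≤ C) ∧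
      Tendsto (fun x => Circle.exp (φ (g x) - φ (f x) - H x)) (cobounded X) (𝓝 1) := by
  let c : C(Corona Y, Circle) := (phaseMap φ hφ).comp ⟨Subtype.val, continuous_subtype_val⟩
  obtain ⟨θ, hθ⟩ := exists_exp_eq_div_of_homotopic
    ((ContinuousMap.Homotopic.refl c).comp h)
  obtain ⟨Θ, hΘ, hslow, hbdd⟩ := exists_extension_of_corona θ
  refine ⟨_, hslow, hbdd, ?_⟩
  let D : C(HigsonCompactification X, Circle) :=
    ⟨fun χ => phaseMap φ hφ (compactificationMap g hg χ) /
      phaseMap φ hφ (compactificationMap f hf χ) / Circle.exp (Θ χ), by fun_prop⟩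
  have hD1 : ∀ χ, χ ∉ Set.range (toHigson (X := X)) → D χ = 1 := by
    intro χ hχ
    have h1 := hθ ⟨χ, hχ⟩
    have h2 := hΘ ⟨χ, hχ⟩
    change _ / _ / Circle.exp (Θ χ) = 1
    rw [div_eq_one, h2, h1]
    rfl
  have hDX : ∀ x, D (toHigson x) = Circle.exp (φ (g x) - φ (f x) - Θ (toHigson x)) := by
    intro x
    rw [Circle.exp_sub, Circle.exp_sub]
    rfl
  simp only [← hDX]
  intro U hU
  obtain ⟨V, hVU, hV, h1V⟩ := mem_nhds_iff.1 hU
  filter_upwards [eventually_toHigson_mem (hV.preimage D.continuous)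
    fun χ hχ => by rw [Set.mem_preimage, hD1 χ hχ]; exact h1V] with x hx
  exact hVU hx

/-- If `νf` and `νg` are homotopic, `φ ∘ g - φ ∘ f` is bounded along every sequence with bounded
steps tending to infinity, for all slowly oscillating `φ`. -/
theorem exists_bound_of_homotopic [ProperSpace X] {e₀ e₁ : X} {e₀' e₁' : Y}
    {f g : C(X, Y)} (hf : IsCoarse e₀ e₀' f) (hg : IsCoarse e₁ e₁' g)
    (h : ContinuousMap.Homotopic (coronaMap f hf) (coronaMap g hg))
    {φ : C(Y, ℝ)} (hφ : IsSlowlyOscillating φ) {x : ℕ → X}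
    (hx : Tendsto x atTop (cobounded X)) {C : ℝ} (hC : ∀ k, dist (x (k + 1)) (x k) ≤ C) :
    ∃ B, ∀ᶠ k in atTop, |φ (g (x k)) - φ (f (x k))| ≤ B := by
  obtain ⟨H, hH, ⟨M, hM⟩, hlim⟩ := exists_bounded_slowlyOscillating_of_homotopic hf hg h hφ
  obtain ⟨B, hB⟩ := exists_bound_of_tendsto_exp_one
    ((((hφ.comp_isCoarse hg).sub (hφ.comp_isCoarse hf)).sub hH).tendsto_sub hx hC)
    (hlim.comp hx)
  refine ⟨B + M, hB.mono fun k hk => ?_⟩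
  have := abs_add_le (φ (g (x k)) - φ (f (x k)) - H (x k)) (H (x k))
  rw [sub_add_cancel] at this
  linarith [hM (x k)]

theorem coronaMap_id_eq [ProperSpace X] {e e' : X}
    (h : IsCoarse e e' (ContinuousMap.id X)) :
    coronaMap (ContinuousMap.id X) h = ContinuousMap.id (Corona X) := by
  ext χ
  rfl

end

/-! ### Slowly oscillating functions on the lattice -/

section

variable {n : ℕ}

/-- The function `x ↦ x_i / √(1 + ‖x‖)` on `ℤ^n`. It is homogeneous of degree `1/2` up to a lower
order term, and thus unbounded but slowly oscillating. -/
def rootCoord (i : Fin n) : C(IntLattice n, ℝ) where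
  toFun x := (x i : ℝ) / √(1 + ‖x‖)
  continuous_toFun := by
    refine Continuous.div ?_ (by fun_prop) fun x => ?_
    · exact continuous_of_discreteTopology.comp
        (PiLp.continuous_apply 2 (fun _ : Fin n => ℤ) i)
    · have := norm_nonneg x
      positivity

theorem rootCoord_apply (i : Fin n) (x : IntLattice n) :
    rootCoord i x = (x i : ℝ) / √(1 + ‖x‖) := rfl

theorem abs_apply_le_norm (x : IntLattice n) (i : Fin n) : |(x i : ℝ)| ≤ ‖x‖ := by
  simpa [Int.norm_eq_abs] using PiLp.norm_apply_le x i

theorem abs_rootCoord_sub_mul_le (i : Fin n) (y z : IntLattice n) :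
    |rootCoord i y - rootCoord i z| * √(1 + ‖y‖) ≤ 2 * dist y z := by
  have hy := norm_nonneg y
  have hz := norm_nonneg z
  rw [rootCoord_apply, rootCoord_apply]
  set s := √(1 + ‖y‖) with hs
  set t := √(1 + ‖z‖) with ht
  have hs0 : 0 < s := by positivity
  have ht0 : 0 < t := by positivity
  have hs2 : s ^ 2 = 1 + ‖y‖ := Real.sq_sqrt (by positivity)
  have ht2 : t ^ 2 = 1 + ‖z‖ := Real.sq_sqrt (by positivity)
  have h1 : |(y i : ℝ) - z i| ≤ dist y z := by
    have := abs_apply_le_norm (y - z) i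
    rw [dist_eq_norm]
    simpa using this
  have h2 : |(z i : ℝ)| ≤ t ^ 2 := by linarith [abs_apply_le_norm z i]
  have h3 : |t ^ 2 - s ^ 2| ≤ dist y z := by
    have := abs_norm_sub_norm_le y z
    rw [← dist_eq_norm, abs_sub_comm] at this
    rwa [hs2, ht2, add_sub_add_left_eq_sub]
  have h4 : |(z i : ℝ) * (t - s) / t| ≤ |t ^ 2 - s ^ 2| := by
    rw [abs_div, abs_mul, abs_of_pos ht0, div_le_iff₀ ht0,
      show t ^ 2 - s ^ 2 = (t + s) * (t - s) by ring, abs_mul, abs_of_pos (add_pos ht0 hs0)]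
    have := mul_le_mul_of_nonneg_right h2 (abs_nonneg (t - s))
    nlinarith [mul_nonneg (mul_pos ht0 hs0).le (abs_nonneg (t - s))]
  calc |(y i : ℝ) / s - z i / t| * s = |((y i : ℝ) / s - z i / t) * s| := by
        rw [abs_mul, abs_of_pos hs0]
    _ = |((y i : ℝ) - z i) + z i * (t - s) / t| := by
        congr 1
        field_simp
        ring
    _ ≤ |(y i : ℝ) - z i| + |(z i : ℝ) * (t - s) / t| := abs_add_le _ _
    _ ≤ 2 * dist y z := by linarith

theorem isSlowlyOscillating_rootCoord (i : Fin n) : IsSlowlyOscillating (rootCoord (n := n) i) := by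
  intro r hr ε hε
  filter_upwards [tendsto_norm_cobounded_atTop.eventually
    (eventually_ge_atTop (r + (4 * r / ε) ^ 2))] with x hx y hy z hz
  have hyn : (4 * r / ε) ^ 2 ≤ 1 + ‖y‖ := by
    have h1 : ‖x‖ - ‖y‖ ≤ dist x y := by rw [dist_eq_norm]; exact norm_sub_norm_le x y
    rw [Metric.mem_ball, dist_comm] at hy
    linarith
  have hsq : 4 * r / ε ≤ √(1 + ‖y‖) := Real.le_sqrt_of_sq_le hyn
  have hyz : dist y z ≤ 2 * r := by
    rw [Metric.mem_ball] at hy hz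
    linarith [dist_triangle_right y z x]
  have key := abs_rootCoord_sub_mul_le i y z
  have hpos : 0 < 4 * r / ε := by positivity
  have h2 : |rootCoord i y - rootCoord i z| * (4 * r / ε) ≤ 4 * r :=
    (mul_le_mul_of_nonneg_left hsq (abs_nonneg _)).trans (by linarith)
  rw [Real.dist_eq]
  rw [← le_div_iff₀ hpos] at h2
  refine h2.trans (le_of_eq ?_)
  field_simp

theorem norm_natCast_smul (k : ℕ) (v : IntLattice n) : ‖(k : ℤ) • v‖ = k * ‖v‖ := by
  rw [norm_smul, Int.norm_natCast]

theorem tendsto_rootCoord_natCast_smul_div_sqrt (i : Fin n) {v : IntLattice n} (hv : v ≠ 0) :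
    Tendsto (fun k : ℕ => rootCoord i ((k : ℤ) • v) / √k) atTop (𝓝 ((v i : ℝ) / √‖v‖)) := by
  have hv' : 0 < ‖v‖ := norm_pos_iff.2 hv
  have hlim : Tendsto (fun k : ℕ => (v i : ℝ) / √((k : ℝ)⁻¹ + ‖v‖)) atTop
      (𝓝 ((v i : ℝ) / √(0 + ‖v‖))) := by
    refine Tendsto.div tendsto_const_nhds ?_ (by rw [zero_add]; positivity)
    exact ((tendsto_inv_atTop_nhds_zero_nat (𝕜 := ℝ)).add_const _).sqrt
  rw [zero_add] at hlim
  refine hlim.congr' ?_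
  filter_upwards [eventually_gt_atTop 0] with k hk
  have hk' : (0 : ℝ) < k := by exact_mod_cast hk
  have hsplit : 1 + (k : ℝ) * ‖v‖ = k * ((k : ℝ)⁻¹ + ‖v‖) := by field_simp
  have hpos : 0 < √((k : ℝ)⁻¹ + ‖v‖) := by positivity
  have hsk : √(k : ℝ) * √(k : ℝ) = k := Real.mul_self_sqrt hk'.le
  have hsk0 : 0 < √(k : ℝ) := by positivity
  rw [rootCoord_apply, norm_natCast_smul, hsplit, Real.sqrt_mul hk'.le, div_div]
  have hcoord : ((((k : ℤ) • v) i : ℤ) : ℝ) = k * v i := by simp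
  rw [hcoord, div_eq_div_iff hpos.ne' (by positivity)]
  linear_combination (v i : ℝ) * √((k : ℝ)⁻¹ + ‖v‖) * hsk

theorem norm_sq_eq_sum (v : IntLattice n) : ‖v‖ ^ 2 = ∑ i, (v i : ℝ) ^ 2 := by
  rw [PiLp.norm_sq_eq_of_L2]
  simp [Int.norm_eq_abs]

/-- The map `v ↦ v / √‖v‖` is injective on nonzero vectors. -/
theorem eq_of_forall_div_sqrt_norm_eq {v w : IntLattice n} (hv : v ≠ 0) (hw : w ≠ 0)
    (h : ∀ i, (v i : ℝ) / √‖v‖ = (w i : ℝ) / √‖w‖) : v = w := by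
  have hv' : 0 < ‖v‖ := norm_pos_iff.2 hv
  have hw' : 0 < ‖w‖ := norm_pos_iff.2 hw
  have hsum : ∀ u : IntLattice n, 0 < ‖u‖ → ∑ i, ((u i : ℝ) / √‖u‖) ^ 2 = ‖u‖ := by
    intro u hu
    simp only [div_pow, Real.sq_sqrt hu.le]
    rw [← Finset.sum_div, ← norm_sq_eq_sum]
    field_simp
  have hnorm : ‖v‖ = ‖w‖ := by
    rw [← hsum v hv', ← hsum w hw']
    simp only [h]
  ext i
  have hi := h i
  rw [hnorm] at hi
  have hpos : √‖w‖ ≠ 0 := by positivity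
  exact_mod_cast (div_left_inj' hpos).1 hi

/-- An injective linear map of `ℤ^n` whose corona map is homotopic to the identity is the identity:
for `T v ≠ v`, some `rootCoord i ∘ T - rootCoord i` grows like `√k` along `k • v`. -/
theorem eq_id_of_homotopic (T : IntLattice n →ₗ[ℤ] IntLattice n) (hT : Function.Injective T)
    (h : ContinuousMap.Homotopic (coronaMap (toContinuousMap T) (isCoarse_of_injective T hT))
      (ContinuousMap.id (Corona (IntLattice n)))) : T = LinearMap.id := by
  refine LinearMap.ext fun v => ?_
  rw [LinearMap.id_apply]
  rcases eq_or_ne v 0 with rfl | hv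
  · exact map_zero T
  have hTv : T v ≠ 0 := (map_ne_zero_iff T hT).2 hv
  have hid : IsCoarse (0 : IntLattice n) (0 : IntLattice n)
      (ContinuousMap.id (IntLattice n)) :=
    isCoarse_of_injective LinearMap.id Function.injective_id
  rw [← coronaMap_id_eq hid] at h
  have hx : Tendsto (fun k : ℕ => (k : ℤ) • v) atTop (cobounded (IntLattice n)) := by
    rw [← tendsto_norm_atTop_iff_cobounded]
    simp only [norm_natCast_smul]
    exact tendsto_natCast_atTop_atTop.atTop_mul_const (norm_pos_iff.2 hv)
  have hC : ∀ k : ℕ, dist (((k + 1 : ℕ) : ℤ) • v) ((k : ℤ) • v) ≤ ‖v‖ := by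
    intro k
    rw [dist_eq_norm, ← sub_smul]
    simp
  refine eq_of_forall_div_sqrt_norm_eq hTv hv fun i => ?_
  obtain ⟨B, hB⟩ := exists_bound_of_homotopic _ hid h (isSlowlyOscillating_rootCoord i) hx hC
  have hlim := (tendsto_rootCoord_natCast_smul_div_sqrt i hv).sub
    (tendsto_rootCoord_natCast_smul_div_sqrt i hTv)
  have hzero : Tendsto (fun k : ℕ => rootCoord i ((k : ℤ) • v) / √k
      - rootCoord i ((k : ℤ) • T v) / √k) atTop (𝓝 0) := by
    refine squeeze_zero_norm' (a := fun k : ℕ => B / √k) ?_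
      ((Real.tendsto_sqrt_atTop.comp tendsto_natCast_atTop_atTop).const_div_atTop B)
    filter_upwards [hB] with k hk
    rw [← sub_div, Real.norm_eq_abs, abs_div, abs_of_nonneg (Real.sqrt_nonneg _)]
    refine div_le_div_of_nonneg_right ?_ (Real.sqrt_nonneg _)
    rw [← map_smul]
    exact hk
  exact (sub_eq_zero.1 (tendsto_nhds_unique hlim hzero)).symm

end

end HigsonCorona

end

/-- An injective linear map `T : ℤ^n → ℤ^n` with a (complex) eigenvalue `μ ≠ 1` induces a map
`νT` of the Higson corona which is not homotopic to the identity. -/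
theorem mainTheorem5 (n : ℕ)
    (T : HigsonCorona.IntLattice n →ₗ[ℤ] HigsonCorona.IntLattice n)
    (hT : Function.Injective T)
    (μ : ℂ) (hμ : Module.End.HasEigenvalue (T.baseChange ℂ) μ) (hμ1 : μ ≠ 1) :
    ¬ ContinuousMap.Homotopic
      (HigsonCorona.coronaMap (HigsonCorona.toContinuousMap T)
        (HigsonCorona.isCoarse_of_injective T hT))
      (ContinuousMap.id (HigsonCorona.Corona (HigsonCorona.IntLattice n))) := by
  intro h
  have hid := HigsonCorona.eq_id_of_homotopic T hT h
  subst hid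
  obtain ⟨x, hx⟩ := hμ.exists_hasEigenvector
  have h1 := hx.apply_eq_smul
  rw [LinearMap.baseChange_id, LinearMap.id_apply] at h1
  have h2 : (μ - 1) • x = 0 := by rw [sub_smul, one_smul, ← h1, sub_self]
  exact (smul_eq_zero.1 h2).elim (fun h => hμ1 (sub_eq_zero.1 h)) hx.2
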